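/- Consider a finite-dimensional quantum system. For operators let $\|A\|_1=\operatorname{Tr}\sqrt{A^\dagger A}$ be the trace norm, and for superoperators (linear maps on operators) let $\|\mathcal B\|_{1\to1}=\sup_{A\neq0}\|\mathcal B A\|_1/\|A\|_1$. Let $T\ge 0$, let $H(t)$, $t\in[0,T]$, be a time-dependent Hamiltonian (Hermitian at each $t$, with integrable entries), and let $\mathcal D$ be a dissipator in Lindblad form, $\mathcal D(\rho)=\sum_k\big(L_k\rho L_k^\dagger-\tfrac12(L_k^\dagger L_k\rho+\rho L_k^\dagger L_k)\big)$ with finitely many jump operators $L_k$. Put $\mathcal L_t\rho=-i[H(t),\rho]+\mathcal D(\rho)$. Let $\rho_0$ be a density matrix and let $(\rho_t)_{t\in[0,T]}$ be the solution of the master equation $\frac{d\rho}{dt}=\mathcal L_t\rho$ with initial state $\rho_0$. (Solutions of differential equations are meant in the integrated sense: $\rho_t$ is continuous and $\rho_t=\rho_0+\int_0^t\mathcal L_s\rho_s\,ds$ for all $t\in[0,T]$.) (1) Let $\tilde H(t)$, $t\in[0,T]$, be another Hamiltonian of the same kind, $\tilde{\mathcal L}_t\rho=-i[\tilde H(t),\rho]$,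 and let $\tilde{\mathcal U}_t$ be the unitary evolution it generates, i.e. for each operator $X$ the curve $t\mapsto\tilde{\mathcal U}_tX$ solves $\frac{d\rho}{dt}=\tilde{\mathcal L}_t\rho$ with initial value $X$. Suppose that $\rho_0$ is a fixed point of this evolution: $\tilde{\mathcal U}_t\rho_0=\rho_0$ for all $t\in[0,T]$. Then $t\mapsto\|\tilde{\mathcal L}_t-\mathcal L_t\|_{1\to1}$ is integrable on $[0,T]$ and $$\|\rho_T-\rho_0\|_1\le\int_0^T\|\tilde{\mathcal L}_t-\mathcal L_t\|_{1\to1}\,dt .$$ Hence, if $\sup_{t\in[0,T]}\|\mathcal L_t-\tilde{\mathcal L}_t\|_{1\to1}$ is finite and positive, $$T\ge\frac{\|\rho_T-\rho_0\|_1}{\sup_{t\in[0,T]}\|\mathcal L_t-\tilde{\mathcal L}_t\|_{1\to1}} ,$$ and the supremum is a maximum if $H$ and $\tilde H$ are continuous on $[0,T]$. (2) (The case $\tilde{\mathcal L}_t=0$.) For every initial density matrix $\rho_0$, the function $t\mapsto\|\mathcal L_t\|_{1\to1}$ is integrable on $[0,T]$ and $\|\rho_T-\rho_0\|_1\le\int_0^T\|\mathcal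 L_t\|_{1\to1}\,dt$. If $T>0$ and this integral is positive, then $$T\ge\frac{\|\rho_T-\rho_0\|_1}{\frac1T\int_0^T\|\mathcal L_t\|_{1\to1}\,dt}.$$ -/

import Mathlib

open scoped ComplexOrder

noncomputable section

namespace OpenSystem

variable {n : Type*} [Fintype n] [DecidableEq n]

/-- Superoperators: linear maps on the operators of a finite-dimensional quantum system. -/
abbrev Superop (n : Type*) : Type _ := Matrix n n ℂ →ₗ[ℂ] Matrix n n ℂ

/-- A density matrix: positive semidefinite with unit trace. -/
def IsDensity (ρ : Matrix n n ℂ) : Prop := ρ.PosSemidef ∧ ρ.trace = 1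

/-- The trace norm (Schatten 1-norm) `Tr √(A† A)`; the square root is taken by the continuous
functional calculus of the Hermitian matrix `A† A`. -/
def traceNorm (A : Matrix n n ℂ) : ℝ :=
  (Matrix.trace (cfc Real.sqrt (A.conjTranspose * A))).re

/-- The induced norm `‖B‖_{1→1}`, the supremum of `‖B A‖₁ / ‖A‖₁` over all `A ≠ 0`. -/
def inducedNorm (B : Superop n) : ℝ :=
  sSup {r : ℝ | ∃ A : Matrix n n ℂ, A ≠ 0 ∧ r = traceNorm (B A) / traceNorm A}

/-- The Hamiltonian superoperator `ρ ↦ -i [H, ρ]`. -/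
def hamGen (H : Matrix n n ℂ) : Superop n where
  toFun ρ := (-Complex.I) • (H * ρ - ρ * H)
  map_add' ρ σ := by
    rw [← smul_add]; congr 1; noncomm_ring
  map_smul' c ρ := by
    simp only [Matrix.mul_smul, Matrix.smul_mul, ← smul_sub, RingHom.id_apply]
    exact smul_comm _ _ _

/-- The dissipator in Lindblad form with jump operators `L k` (nonnegative rates are absorbed
into the jump operators): `ρ ↦ ∑ₖ (Lₖ ρ Lₖ† - ½ (Lₖ† Lₖ ρ + ρ Lₖ† Lₖ))`. -/
def dissipator {ι : Type*} [Fintype ι] (L : ι → Matrix n n ℂ) : Superop n where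
  toFun ρ := ∑ k, (L k * ρ * (L k).conjTranspose
    - (1 / 2 : ℂ) • ((L k).conjTranspose * L k * ρ + ρ * ((L k).conjTranspose * L k)))
  map_add' ρ σ := by
    rw [← Finset.sum_add_distrib]
    refine Finset.sum_congr rfl fun k _ => ?_
    simp only [mul_add, add_mul, smul_add]
    abel
  map_smul' c ρ := by
    rw [RingHom.id_apply, Finset.smul_sum]
    refine Finset.sum_congr rfl fun k _ => ?_
    simp only [Matrix.mul_smul, Matrix.smul_mul, ← smul_add, smul_sub]
    rw [smul_comm]

/-- The Lindblad generator `ρ ↦ -i [H, ρ] + 𝒟(ρ)`. -/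
def lindbladGen {ι : Type*} [Fintype ι] (H : Matrix n n ℂ) (L : ι → Matrix n n ℂ) : Superop n :=
  hamGen H + dissipator L

/-- A time-dependent Hamiltonian on `[0, T]`: Hermitian at each time, with Lebesgue integrable
matrix entries. -/
structure IsHamiltonian (T : ℝ) (H : ℝ → Matrix n n ℂ) : Prop where
  hermitian : ∀ t ∈ Set.Icc 0 T, (H t).IsHermitian
  integrable : ∀ i j, IntervalIntegrable (fun t => H t i j) MeasureTheory.volume 0 T

/-- `ρ` solves `dρ/dt = 𝓖 t (ρ t)` on `[0, T]` with `ρ 0 = X`, in the sense of Carathéodory: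
`ρ` is continuous and `ρ t = X + ∫₀ᵗ 𝓖 s (ρ s) ds` (entrywise), so that the differential equation
holds for almost every `t`, and for every `t` if `𝓖` is continuous. -/
structure IsSolution (𝓖 : ℝ → Superop n) (T : ℝ) (X : Matrix n n ℂ)
    (ρ : ℝ → Matrix n n ℂ) : Prop where
  continuousOn : ContinuousOn ρ (Set.Icc 0 T)
  integrable : ∀ i j, IntervalIntegrable (fun s => 𝓖 s (ρ s) i j) MeasureTheory.volume 0 T
  eq_integral : ∀ t ∈ Set.Icc 0 T, ∀ i j, ρ t i j = X i j + ∫ s in (0 : ℝ)..t, 𝓖 s (ρ s) i j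

/-- The family of superoperators `E t` is the evolution generated by `𝓖` on `[0, T]`: for each
initial operator `X`, the curve `t ↦ E t X` solves the equation with initial value `X`. -/
def IsEvolution (𝓖 : ℝ → Superop n) (T : ℝ) (E : ℝ → Superop n) : Prop :=
  ∀ X : Matrix n n ℂ, IsSolution 𝓖 T X (fun t => E t X)

end OpenSystem

end

set_option linter.unusedSectionVars false

namespace OpenSystem

open Matrix MeasureTheory Filter Topology Set

variable {n ι : Type*} [Fintype n] [DecidableEq n] [Fintype ι]

/-! The deviation `δ = ρ - ρ₀` satisfies `δ' = 𝓛 δ + 𝓛 ρ₀`. A Lindblad generator is dissipative for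
the trace norm: some contraction `Y` norms `δ`, that is `Re Tr(Y δ) = ‖δ‖₁`, and satisfies `Re Tr(Y
𝓛 δ) ≤ 0` (`exists_contraction_dissipative`). Hence `‖δ‖₁` grows at rate at most `‖𝓛 ρ₀‖₁`
(`ae_deriv_traceNorm_le`), with no appeal to propagators or complete positivity. Since `ρ₀` is fixed
by the comparison evolution, its generator kills `ρ₀` at almost every time, so `‖𝓛 ρ₀‖₁ = ‖(𝓛' - 𝓛)
ρ₀‖₁ ≤ ‖𝓛' - 𝓛‖`, using `‖ρ₀‖₁ ≤ 1`. Absolute continuity of `‖δ‖₁` lets the rate be integrated. Part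
(2) is the comparison Hamiltonian `0`. -/

/-! ### Polar decomposition. -/

theorem continuousOn_spectrum (A : Matrix n n ℂ) (f : ℝ → ℝ) : ContinuousOn f (spectrum ℝ A) :=
  (Matrix.finite_real_spectrum (A := A)).continuousOn f

/-- A polar decomposition `X = W R²` with `W` a partial isometry and `R = |X|^{1/2}`. -/
theorem exists_polar (X : Matrix n n ℂ) :
    ∃ W R : Matrix n n ℂ, X = W * (R * R) ∧ Rᴴ = R ∧ (1 - Wᴴ * W).PosSemidef ∧
      Wᴴ * X = R * R ∧ traceNorm X = (R * R).trace.re := by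
  set M := Xᴴ * X with hM
  have hMpsd : M.PosSemidef := posSemidef_conjTranspose_mul_self X
  have hsa : IsSelfAdjoint M := hMpsd.isHermitian
  have hpos : ∀ x ∈ spectrum ℝ M, 0 ≤ x := by
    intro x hx
    have := (Matrix.posSemidef_iff_isHermitian_and_spectrum_nonneg.1 hMpsd).2
      ((spectrum.algebraMap_mem_iff ℂ).2 hx)
    simpa using this
  have hc := continuousOn_spectrum M
  have hmul : ∀ f g : ℝ → ℝ, cfc f M * cfc g M = cfc (fun x => f x * g x) M := fun f g =>
    (cfc_mul f g M (hc f) (hc g)).symm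
  have hherm : ∀ f : ℝ → ℝ, (cfc f M)ᴴ = cfc f M := fun f => (cfc_predicate f M : IsSelfAdjoint _)
  have hid : cfc (fun x : ℝ => x) M = M := cfc_id' ℝ M
  have hRR : cfc (fun x => √√x) M * cfc (fun x => √√x) M = cfc Real.sqrt M := by
    rw [hmul]
    exact cfc_congr fun x _ => Real.mul_self_sqrt (Real.sqrt_nonneg x)
  have hWR : cfc (fun x => (√x)⁻¹) M * cfc Real.sqrt M = cfc (fun x => (√x)⁻¹ * √x) M := hmul _ _
  -- As `0⁻¹ = 0`, the second factor `Q` is the spectral projection onto `ker M`; `X Q = 0` because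
  -- `(X Q)ᴴ (X Q) = Q M Q = 0`.
  have hQ : X * (1 - cfc (fun x => (√x)⁻¹ * √x) M) = 0 := by
    rw [← conjTranspose_mul_self_eq_zero]
    have h1 : 1 - cfc (fun x => (√x)⁻¹ * √x) M = cfc (fun x => 1 - (√x)⁻¹ * √x) M := by
      rw [cfc_sub _ _ M (hc _) (hc _), cfc_const_one ℝ M]
    rw [h1, conjTranspose_mul, hherm, Matrix.mul_assoc, ← Matrix.mul_assoc Xᴴ, ← hM]
    nth_rewrite 2 [← hid]
    rw [hmul, hmul, ← cfc_zero ℝ M]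
    refine cfc_congr fun x hx => ?_
    rcases (hpos x hx).eq_or_lt with h | h
    · simp [← h]
    · have : √x ≠ 0 := (Real.sqrt_pos.2 h).ne'
      simp [this]
  refine ⟨X * cfc (fun x => (√x)⁻¹) M, cfc (fun x => √√x) M, ?_, hherm _, ?_, ?_, ?_⟩
  · rw [hRR, Matrix.mul_assoc, hWR]
    rw [mul_sub, mul_one, sub_eq_zero] at hQ
    exact hQ
  · rw [conjTranspose_mul, hherm, Matrix.mul_assoc, ← Matrix.mul_assoc Xᴴ, ← hM]
    nth_rewrite 2 [← hid]
    rw [hmul, hmul, ← cfc_const_one ℝ M, ← cfc_sub _ _ M (hc _) (hc _)]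
    -- On the spectrum this function is the indicator of `0`, so its value at `M` is a projection `P
    -- = Pᴴ P`.
    have : cfc (fun x => 1 - (√x)⁻¹ * (x * (√x)⁻¹)) M =
        (cfc (fun x => 1 - (√x)⁻¹ * (x * (√x)⁻¹)) M)ᴴ *
          cfc (fun x => 1 - (√x)⁻¹ * (x * (√x)⁻¹)) M := by
      rw [hherm, hmul]
      refine cfc_congr fun x hx => ?_
      rcases (hpos x hx).eq_or_lt with h | h
      · simp [← h]
      · have h0 : √x ≠ 0 := (Real.sqrt_pos.2 h).ne'
        have : (√x)⁻¹ * (x * (√x)⁻¹) = 1 := by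
          field_simp
          rw [Real.sq_sqrt h.le]
        simp [this]
    rw [this]
    exact posSemidef_conjTranspose_mul_self _
  · rw [conjTranspose_mul, hherm, Matrix.mul_assoc, ← hM, hRR]
    nth_rewrite 2 [← hid]
    rw [hmul]
    refine cfc_congr fun x hx => ?_
    rw [← div_eq_inv_mul, Real.div_sqrt]
  · rw [hRR]
    rfl

/-! ### Trace duality and the norm properties of the trace norm. -/

theorem re_trace_conjTranspose_mul_self_nonneg (A : Matrix n n ℂ) : 0 ≤ (Aᴴ * A).trace.re :=
  (Complex.le_def.1 (posSemidef_conjTranspose_mul_self A).trace_nonneg).1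

theorem re_trace_conjTranspose (A : Matrix n n ℂ) : (Aᴴ).trace.re = A.trace.re := by
  rw [trace_conjTranspose]
  exact Complex.conj_re _

/-- The arithmetic-geometric Cauchy-Schwarz inequality for the Hilbert-Schmidt inner product. -/
theorem re_trace_conjTranspose_mul_le (A B : Matrix n n ℂ) :
    (Aᴴ * B).trace.re ≤ ((Aᴴ * A).trace.re + (Bᴴ * B).trace.re) / 2 := by
  have h := re_trace_conjTranspose_mul_self_nonneg (A - B)
  have h2 : (Bᴴ * A).trace.re = (Aᴴ * B).trace.re := by
    rw [← re_trace_conjTranspose]; simp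
  simp only [conjTranspose_sub, sub_mul, mul_sub, trace_sub, Complex.sub_re] at h
  linarith

/-- Inserting a contraction between two factors decreases the Hilbert-Schmidt norm. -/
theorem re_trace_contraction_le {W : Matrix n n ℂ} (hW : (1 - Wᴴ * W).PosSemidef)
    (A : Matrix n n ℂ) : ((W * A)ᴴ * (W * A)).trace.re ≤ (Aᴴ * A).trace.re := by
  have h := (Complex.le_def.1 (hW.conjTranspose_mul_mul_same A).trace_nonneg).1
  simp only [mul_sub, sub_mul, mul_one, trace_sub, Complex.sub_re, Complex.zero_re] at h
  rw [conjTranspose_mul]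
  simp only [Matrix.mul_assoc] at h ⊢
  linarith

/-- Trace duality: contractions test the trace norm. -/
theorem re_trace_mul_le_traceNorm {Y : Matrix n n ℂ} (hY : (1 - Y * Yᴴ).PosSemidef)
    (A : Matrix n n ℂ) : (Y * A).trace.re ≤ traceNorm A := by
  obtain ⟨W, R, hA, hR, hW, -, hN⟩ := exists_polar A
  -- Sharing `|A| = R R` evenly between the two factors bounds each squared Hilbert-Schmidt norm by
  -- `Tr |A|`.
  have h1 : (Y * A).trace = ((Yᴴ * R)ᴴ * (W * R)).trace := by
    rw [conjTranspose_mul, conjTranspose_conjTranspose, hR, Matrix.mul_assoc, Matrix.trace_mul_comm R, hA]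
    simp only [Matrix.mul_assoc]
  have h2 := re_trace_contraction_le (W := Yᴴ) (by rwa [conjTranspose_conjTranspose]) R
  have h3 := re_trace_contraction_le hW R
  have h4 := re_trace_conjTranspose_mul_le (Yᴴ * R) (W * R)
  rw [hR] at h2 h3
  rw [h1, hN]
  linarith

/-- The trace norm is attained at a contraction. -/
theorem exists_contraction (A : Matrix n n ℂ) :
    ∃ Y : Matrix n n ℂ, (1 - Y * Yᴴ).PosSemidef ∧ (Y * A).trace.re = traceNorm A := by
  obtain ⟨W, R, -, -, hW, hWA, hN⟩ := exists_polar A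
  exact ⟨Wᴴ, by rwa [conjTranspose_conjTranspose], by rw [hWA, hN]⟩

theorem traceNorm_nonneg (A : Matrix n n ℂ) : 0 ≤ traceNorm A := by
  have := re_trace_mul_le_traceNorm (Y := 0) (by simpa using PosSemidef.one) A
  simpa using this

theorem traceNorm_add_le (A B : Matrix n n ℂ) : traceNorm (A + B) ≤ traceNorm A + traceNorm B := by
  obtain ⟨Y, hY, h⟩ := exists_contraction (A + B)
  rw [← h, mul_add, trace_add, Complex.add_re]
  exact add_le_add (re_trace_mul_le_traceNorm hY A) (re_trace_mul_le_traceNorm hY B)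

theorem traceNorm_zero : traceNorm (0 : Matrix n n ℂ) = 0 := by
  obtain ⟨Y, -, h⟩ := exists_contraction (0 : Matrix n n ℂ)
  simpa using h.symm

theorem traceNorm_sum_le {κ : Type*} (s : Finset κ) (A : κ → Matrix n n ℂ) :
    traceNorm (∑ k ∈ s, A k) ≤ ∑ k ∈ s, traceNorm (A k) :=
  Finset.le_sum_of_subadditive _ traceNorm_zero.le traceNorm_add_le s A

theorem traceNorm_smul_le (c : ℂ) (A : Matrix n n ℂ) : traceNorm (c • A) ≤ ‖c‖ * traceNorm A := by
  rcases eq_or_ne c 0 with rfl | hc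
  · simp [traceNorm_zero]
  obtain ⟨Y, hY, h⟩ := exists_contraction (c • A)
  have hn : (‖c‖ : ℂ) ≠ 0 := by simpa using hc
  -- The phase of `c` is absorbed into the contraction.
  have hY' : (1 - ((c / ‖c‖) • Y) * ((c / ‖c‖) • Y)ᴴ).PosSemidef := by
    have : (c / ‖c‖) * star (c / ‖c‖) = 1 := by
      rw [Complex.star_def, Complex.mul_conj']
      simp [hc]
    rwa [conjTranspose_smul, smul_mul_smul_comm, this, one_smul]
  have h1 := re_trace_mul_le_traceNorm hY' A
  have h2 : (Y * c • A).trace = (‖c‖ : ℂ) * ((c / ‖c‖) • Y * A).trace := by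
    rw [Matrix.mul_smul, Matrix.smul_mul, trace_smul, trace_smul, smul_eq_mul, smul_eq_mul,
      ← mul_assoc, mul_div_cancel₀ _ hn]
  rw [← h, h2, Complex.re_ofReal_mul]
  exact mul_le_mul_of_nonneg_left h1 (norm_nonneg c)

theorem traceNorm_neg (A : Matrix n n ℂ) : traceNorm (-A) = traceNorm A := by
  have key : ∀ B : Matrix n n ℂ, traceNorm (-B) ≤ traceNorm B := fun B => by
    simpa using traceNorm_smul_le (-1) B
  exact le_antisymm (key A) (by simpa using key (-A))

theorem abs_traceNorm_sub_le (A B : Matrix n n ℂ) :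
    |traceNorm A - traceNorm B| ≤ traceNorm (A - B) := by
  have h1 := traceNorm_add_le (A - B) B
  have h2 := traceNorm_add_le (-(A - B)) A
  rw [traceNorm_neg, show -(A - B) + A = B by abel] at h2
  rw [sub_add_cancel] at h1
  rw [abs_le]
  constructor <;> linarith

/-- The matrix unit at `(j, i)` is a contraction that reads off the entry; a phase makes the entry
real. -/
theorem norm_apply_le_traceNorm (A : Matrix n n ℂ) (i j : n) : ‖A i j‖ ≤ traceNorm A := by
  rcases eq_or_ne (A i j) 0 with h0 | h0
  · simpa [h0] using traceNorm_nonneg A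
  have hY : (1 - Matrix.single j i (1 : ℂ) * (Matrix.single j i (1 : ℂ))ᴴ).PosSemidef := by
    have : (1 - Matrix.single j i (1 : ℂ) * (Matrix.single j i (1 : ℂ))ᴴ) =
        Matrix.diagonal (fun k => if k = j then (0 : ℂ) else 1) := by
      rw [conjTranspose_single, single_mul_single_same]
      ext a b
      by_cases hab : a = b <;> by_cases ha : a = j <;>
        simp_all [Matrix.single, Matrix.diagonal, Matrix.one_apply, eq_comm]
    rw [this, posSemidef_diagonal_iff]
    intro k
    split_ifs <;> simp
  have h1 := re_trace_mul_le_traceNorm hY ((star (A i j) / ‖A i j‖) • A)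
  have h2 := traceNorm_smul_le (star (A i j) / ‖A i j‖) A
  have h3 : ‖star (A i j) / (‖A i j‖ : ℂ)‖ = 1 := by simp [h0]
  have h4 : (Matrix.single j i (1 : ℂ) * ((star (A i j) / ‖A i j‖) • A)).trace = ‖A i j‖ := by
    have : (‖A i j‖ : ℂ) ≠ 0 := by simpa using h0
    rw [Matrix.mul_smul, trace_smul, Matrix.trace_single_mul, smul_eq_mul, one_smul]
    rw [div_mul_eq_mul_div, div_eq_iff this, Complex.star_def, mul_comm, Complex.mul_conj', sq]
  rw [h3, one_mul] at h2
  rw [h4, Complex.ofReal_re] at h1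
  exact h1.trans h2

theorem traceNorm_pos {A : Matrix n n ℂ} (hA : A ≠ 0) : 0 < traceNorm A := by
  by_contra! h
  refine hA (Matrix.ext fun i j => ?_)
  exact norm_le_zero_iff.1 ((norm_apply_le_traceNorm A i j).trans h)

theorem traceNorm_le_one_of_isDensity {ρ : Matrix n n ℂ} (h : IsDensity ρ) : traceNorm ρ ≤ 1 := by
  obtain ⟨Y, hY, hN⟩ := exists_contraction ρ
  obtain ⟨S, rfl⟩ : ∃ S : Matrix n n ℂ, ρ = Sᴴ * S := by
    open scoped MatrixOrder in
    exact ⟨CFC.sqrt ρ, by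
      rw [((CFC.sqrt_nonneg ρ).posSemidef.isHermitian).eq, CFC.sqrt_mul_sqrt_self ρ h.1.nonneg]⟩
  have h1 : (Y * (Sᴴ * S)).trace = ((Yᴴ * Sᴴ)ᴴ * Sᴴ).trace := by
    rw [conjTranspose_mul, conjTranspose_conjTranspose, conjTranspose_conjTranspose,
      Matrix.mul_assoc, Matrix.trace_mul_comm S, Matrix.mul_assoc]
  have h2 := re_trace_contraction_le (W := Yᴴ) (by rwa [conjTranspose_conjTranspose]) Sᴴ
  have h3 := re_trace_conjTranspose_mul_le (Yᴴ * Sᴴ) Sᴴ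
  have h4 : (Sᴴᴴ * Sᴴ).trace.re = 1 := by
    rw [conjTranspose_conjTranspose, Matrix.trace_mul_comm, h.2, Complex.one_re]
  rw [← hN, h1]
  linarith

/-- Expansion in matrix units; the source of all finite-dimensional bounds below. -/
theorem traceNorm_le_sum (A : Matrix n n ℂ) (F : Superop n) :
    traceNorm (F A) ≤ ∑ i, ∑ j, ‖A i j‖ * traceNorm (F (Matrix.single i j 1)) := by
  have hA : A = ∑ i, ∑ j, A i j • Matrix.single i j (1 : ℂ) := by
    conv_lhs => rw [Matrix.matrix_eq_sum_single A]
    simp [Matrix.smul_single]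
  conv_lhs => rw [hA]
  simp only [map_sum, map_smul]
  refine (traceNorm_sum_le _ _).trans (Finset.sum_le_sum fun i _ => ?_)
  exact (traceNorm_sum_le _ _).trans (Finset.sum_le_sum fun j _ => traceNorm_smul_le _ _)

/-! ### Dissipativity. -/

/-- Hamiltonian and Lindblad generators are dissipative for the trace norm. -/
theorem exists_contraction_dissipative {H : Matrix n n ℂ} (hH : H.IsHermitian)
    (L : ι → Matrix n n ℂ) (X : Matrix n n ℂ) :
    ∃ Y : Matrix n n ℂ, (1 - Y * Yᴴ).PosSemidef ∧ (Y * X).trace.re = traceNorm X ∧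
      (Y * lindbladGen H L X).trace.re ≤ 0 := by
  obtain ⟨W, R, hX, hR, hW, hWX, hN⟩ := exists_polar X
  refine ⟨Wᴴ, by rwa [conjTranspose_conjTranspose], by rw [hWX, hN], ?_⟩
  -- The trace of a product of two Hermitian matrices is real, so the factor `-i` makes the
  -- Hamiltonian part purely imaginary.
  have him : ∀ P : Matrix n n ℂ, Pᴴ = P → (H * P).trace.im = 0 := fun P hP => by
    rw [← Complex.conj_eq_iff_im, ← Complex.star_def, ← trace_conjTranspose, conjTranspose_mul,
      hP, hH.eq, trace_mul_comm]
  have hHam : (Wᴴ * hamGen H X).trace.re = 0 := by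
    have e1 : (Wᴴ * (H * X)).trace = (H * (W * (R * R) * Wᴴ)).trace := by
      rw [trace_mul_comm, Matrix.mul_assoc, ← hX]
    have e2 : (Wᴴ * (X * H)).trace = (H * (R * R)).trace := by
      rw [← Matrix.mul_assoc, hWX, trace_mul_comm]
    have i1 := him (W * (R * R) * Wᴴ) (by simp [hR, Matrix.mul_assoc])
    have i2 := him (R * R) (by simp [hR])
    simp only [hamGen, LinearMap.coe_mk, AddHom.coe_mk, Matrix.mul_smul, trace_smul, mul_sub,
      trace_sub, e1, e2]
    simp [i1, i2]
  have hDis : (Wᴴ * dissipator L X).trace.re ≤ 0 := by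
    simp only [dissipator, LinearMap.coe_mk, AddHom.coe_mk, Matrix.mul_sum, trace_sum,
      Complex.re_sum]
    refine Finset.sum_nonpos fun k _ => ?_
    set K := L k
    have e1 : (Wᴴ * (K * X * Kᴴ)).trace = ((W * (K * R))ᴴ * (K * W * R)).trace := by
      have : Wᴴ * (K * X * Kᴴ) = (Wᴴ * K * W * R) * (R * Kᴴ) := by
        simp only [hX, Matrix.mul_assoc]
      rw [this, trace_mul_comm]
      simp only [conjTranspose_mul, hR, Matrix.mul_assoc]
    have e2 : (Wᴴ * (Kᴴ * K * X)).trace = ((K * W * R)ᴴ * (K * W * R)).trace := by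
      have : Wᴴ * (Kᴴ * K * X) = (Wᴴ * Kᴴ * K * W * R) * R := by
        simp only [hX, Matrix.mul_assoc]
      rw [this, trace_mul_comm]
      simp only [conjTranspose_mul, hR, Matrix.mul_assoc]
    have e3 : (Wᴴ * (X * (Kᴴ * K))).trace = ((K * R)ᴴ * (K * R)).trace := by
      rw [← Matrix.mul_assoc, hWX, Matrix.mul_assoc, trace_mul_comm]
      simp only [conjTranspose_mul, hR, Matrix.mul_assoc]
    -- The jump term is at most `½(‖W K R‖² + ‖K W R‖²)` in Hilbert-Schmidt norm. The anticommutator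
    -- subtracts `½(‖K W R‖² + ‖K R‖²)`, which dominates since `W` is a contraction.
    have h1 := re_trace_conjTranspose_mul_le (W * (K * R)) (K * W * R)
    have h2 := re_trace_contraction_le hW (K * R)
    rw [mul_sub, Matrix.mul_smul, mul_add, trace_sub, trace_smul, trace_add, e1, e2, e3,
      Complex.sub_re, smul_eq_mul, show (1 / 2 : ℂ) = ((1 / 2 : ℝ) : ℂ) by norm_num,
      Complex.re_ofReal_mul, Complex.add_re]
    linarith
  rw [lindbladGen, LinearMap.add_apply, mul_add, trace_add, Complex.add_re, hHam, zero_add]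
  exact hDis

/-! ### The induced norm. -/

theorem bddAbove_inducedNorm (B : Superop n) :
    BddAbove {r : ℝ | ∃ A : Matrix n n ℂ, A ≠ 0 ∧ r = traceNorm (B A) / traceNorm A} := by
  refine ⟨∑ i, ∑ j, traceNorm (B (Matrix.single i j 1)), ?_⟩
  rintro _ ⟨A, hA, rfl⟩
  rw [div_le_iff₀ (traceNorm_pos hA)]
  refine (traceNorm_le_sum A B).trans ?_
  rw [Finset.sum_mul]
  refine Finset.sum_le_sum fun i _ => ?_
  rw [Finset.sum_mul]
  refine Finset.sum_le_sum fun j _ => ?_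
  rw [mul_comm]
  exact mul_le_mul_of_nonneg_left (norm_apply_le_traceNorm A i j) (traceNorm_nonneg _)

theorem inducedNorm_nonneg (B : Superop n) : 0 ≤ inducedNorm B := by
  refine Real.sSup_nonneg ?_
  rintro _ ⟨A, -, rfl⟩
  exact div_nonneg (traceNorm_nonneg _) (traceNorm_nonneg _)

theorem traceNorm_apply_le (B : Superop n) (A : Matrix n n ℂ) :
    traceNorm (B A) ≤ inducedNorm B * traceNorm A := by
  rcases eq_or_ne A 0 with rfl | hA
  · simp [traceNorm_zero]
  rw [← div_le_iff₀ (traceNorm_pos hA)]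
  exact le_csSup (bddAbove_inducedNorm B) ⟨A, hA, rfl⟩

theorem inducedNorm_le {B : Superop n} {c : ℝ} (hc : 0 ≤ c)
    (h : ∀ A, traceNorm (B A) ≤ c * traceNorm A) : inducedNorm B ≤ c := by
  -- `0 ≤ c` covers the zero-dimensional system, where the supremum is over the empty set.
  refine Real.sSup_le ?_ hc
  rintro _ ⟨A, hA, rfl⟩
  rw [div_le_iff₀ (traceNorm_pos hA)]
  exact h A

theorem inducedNorm_add_le (B C : Superop n) :
    inducedNorm (B + C) ≤ inducedNorm B + inducedNorm C := by
  refine inducedNorm_le (add_nonneg (inducedNorm_nonneg B) (inducedNorm_nonneg C)) fun A => ?_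
  rw [add_mul, LinearMap.add_apply]
  exact (traceNorm_add_le _ _).trans
    (add_le_add (traceNorm_apply_le B A) (traceNorm_apply_le C A))

theorem inducedNorm_neg (B : Superop n) : inducedNorm (-B) = inducedNorm B := by
  simp only [inducedNorm, LinearMap.neg_apply, traceNorm_neg]

theorem inducedNorm_sub_comm (B C : Superop n) : inducedNorm (B - C) = inducedNorm (C - B) := by
  rw [← inducedNorm_neg, neg_sub]

/-! ### Dependence of the generator norm on the Hamiltonian: continuity and integrability. -/

theorem hamGen_sub (H K : Matrix n n ℂ) : hamGen (H - K) = hamGen H - hamGen K := by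
  ext1 A
  simp only [hamGen, LinearMap.sub_apply, LinearMap.coe_mk, AddHom.coe_mk, ← smul_sub]
  congr 1
  noncomm_ring

theorem hamGen_zero : hamGen (0 : Matrix n n ℂ) = 0 := by
  rw [← sub_self (0 : Matrix n n ℂ), hamGen_sub, sub_self]

theorem inducedNorm_hamGen_le : ∃ C : ℝ, ∀ K : Matrix n n ℂ,
    inducedNorm (hamGen K) ≤ C * traceNorm K := by
  refine ⟨∑ i : n, ∑ j : n, inducedNorm (hamGen (-Matrix.single i j (1 : ℂ))), fun K => ?_⟩
  have h0 : 0 ≤ ∑ i : n, ∑ j : n, inducedNorm (hamGen (-Matrix.single i j (1 : ℂ))) :=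
    Finset.sum_nonneg fun i _ => Finset.sum_nonneg fun j _ => inducedNorm_nonneg _
  -- Antisymmetry of the commutator turns a bound for a fixed generator into one linear in `K`.
  have hswap : ∀ E : Matrix n n ℂ, hamGen K E = hamGen (-E) K := fun E => by
    simp only [hamGen, LinearMap.coe_mk, AddHom.coe_mk]
    congr 1
    noncomm_ring
  refine inducedNorm_le (mul_nonneg h0 (traceNorm_nonneg K)) fun A => ?_
  refine (traceNorm_le_sum A (hamGen K)).trans ?_
  simp only [Finset.sum_mul]
  refine Finset.sum_le_sum fun i _ => Finset.sum_le_sum fun j _ => ?_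
  rw [hswap, mul_comm]
  exact mul_le_mul (traceNorm_apply_le _ _) (norm_apply_le_traceNorm A i j) (norm_nonneg _)
    (mul_nonneg (inducedNorm_nonneg _) (traceNorm_nonneg _))

theorem traceNorm_le_sum_norm (A : Matrix n n ℂ) :
    traceNorm A ≤ ∑ i, ∑ j, ‖A i j‖ * traceNorm (Matrix.single i j (1 : ℂ)) :=
  traceNorm_le_sum A LinearMap.id

/-- The `1 → 1` norm of `ρ ↦ -i [K, ρ] - D ρ` is Lipschitz in `K` for the trace norm. -/
theorem exists_lipschitz_inducedNorm (D : Superop n) : ∃ C : ℝ, 0 ≤ C ∧ ∀ K K' : Matrix n n ℂ,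
    |inducedNorm (hamGen K - D) - inducedNorm (hamGen K' - D)| ≤ C * traceNorm (K - K') := by
  obtain ⟨C, hC⟩ := inducedNorm_hamGen_le (n := n)
  have key : ∀ K K' : Matrix n n ℂ, inducedNorm (hamGen K - D) - inducedNorm (hamGen K' - D) ≤
      |C| * traceNorm (K - K') := fun K K' => by
    have h1 := inducedNorm_add_le (hamGen (K - K')) (hamGen K' - D)
    rw [hamGen_sub, sub_add_sub_cancel, ← hamGen_sub] at h1
    have h2 := mul_le_mul_of_nonneg_right (le_abs_self C) (traceNorm_nonneg (K - K'))
    linarith [hC (K - K')]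
  refine ⟨|C|, abs_nonneg C, fun K K' => abs_sub_le_iff.2 ⟨key K K', ?_⟩⟩
  rw [← traceNorm_neg, neg_sub]
  exact key K' K

theorem continuous_inducedNorm_hamGen_sub (D : Superop n) :
    Continuous fun K : Matrix n n ℂ => inducedNorm (hamGen K - D) := by
  obtain ⟨C, hC0, hC⟩ := exists_lipschitz_inducedNorm D
  refine continuous_iff_continuousAt.2 fun K₀ => ?_
  rw [ContinuousAt, tendsto_iff_dist_tendsto_zero]
  have hlim : Tendsto (fun K : Matrix n n ℂ =>
      C * ∑ i, ∑ j, ‖(K - K₀) i j‖ * traceNorm (Matrix.single i j (1 : ℂ))) (𝓝 K₀) (𝓝 0) := by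
    have hc : Continuous fun K : Matrix n n ℂ =>
        C * ∑ i, ∑ j, ‖(K - K₀) i j‖ * traceNorm (Matrix.single i j (1 : ℂ)) := by
      simp only [Matrix.sub_apply]
      fun_prop
    simpa using hc.tendsto K₀
  refine squeeze_zero (fun _ => dist_nonneg) (fun K => ?_) hlim
  rw [Real.dist_eq]
  exact (hC K K₀).trans (mul_le_mul_of_nonneg_left (traceNorm_le_sum_norm _) hC0)

theorem intervalIntegrable_inducedNorm {a b : ℝ} {K : ℝ → Matrix n n ℂ} (D : Superop n)
    (hK : ∀ i j, IntervalIntegrable (fun t => K t i j) volume a b) :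
    IntervalIntegrable (fun t => inducedNorm (hamGen (K t) - D)) volume a b := by
  obtain ⟨C, hC0, hC⟩ := exists_lipschitz_inducedNorm D
  have hbound : IntervalIntegrable (fun t => inducedNorm (hamGen (0 : Matrix n n ℂ) - D) +
      C * ∑ i, ∑ j, ‖K t i j‖ * traceNorm (Matrix.single i j (1 : ℂ))) volume a b := by
    refine intervalIntegrable_const.add (IntervalIntegrable.const_mul ?_ C)
    have hsum : (fun t => ∑ i, ∑ j, ‖K t i j‖ * traceNorm (Matrix.single i j (1 : ℂ))) =
        ∑ i, ∑ j, fun t => ‖K t i j‖ * traceNorm (Matrix.single i j (1 : ℂ)) := by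
      ext t
      simp
    rw [hsum]
    exact IntervalIntegrable.sum Finset.univ fun i _ => IntervalIntegrable.sum Finset.univ
      fun j _ => (hK i j).norm.mul_const _
  have hmeas : AEMeasurable (fun t => inducedNorm (hamGen (K t) - D))
      (volume.restrict (uIoc a b)) := by
    have hK' : AEMeasurable (fun t i j => K t i j) (volume.restrict (uIoc a b)) :=
      aemeasurable_pi_iff.2 fun i => aemeasurable_pi_iff.2 fun j =>
        (intervalIntegrable_iff.1 (hK i j)).aestronglyMeasurable.aemeasurable
    have hc : Continuous fun K : n → n → ℂ => inducedNorm (hamGen (Matrix.of K) - D) :=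
      continuous_inducedNorm_hamGen_sub D
    exact hc.measurable.comp_aemeasurable hK'
  refine hbound.mono_fun' hmeas.aestronglyMeasurable (Eventually.of_forall fun t => ?_)
  dsimp only
  rw [Real.norm_of_nonneg (inducedNorm_nonneg _)]
  have h1 := (abs_le.1 (hC (K t) 0)).2
  have h2 := mul_le_mul_of_nonneg_left (traceNorm_le_sum_norm (K t)) hC0
  rw [sub_zero] at h1
  linarith

/-! ### Differentiating solutions in time. -/

/-- A constant solution is annihilated by the generator at almost every time. -/
theorem ae_apply_eq_zero_of_fixed {𝓖 : ℝ → Superop n} {T : ℝ} (hT : 0 ≤ T) {X : Matrix n n ℂ}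
    {ρ : ℝ → Matrix n n ℂ} (hρ : IsSolution 𝓖 T X ρ) (hfix : ∀ t ∈ Icc 0 T, ρ t = X) :
    ∀ᵐ t, t ∈ Ioo 0 T → 𝓖 t X = 0 := by
  have h : ∀ᵐ t, ∀ i j, t ∈ uIcc 0 T → ∀ c ∈ uIcc 0 T,
      HasDerivAt (fun x => ∫ s in c..x, 𝓖 s (ρ s) i j) (𝓖 t (ρ t) i j) t :=
    ae_all_iff.2 fun i => ae_all_iff.2 fun j => (hρ.integrable i j).ae_hasDerivAt_integral
  rw [uIcc_of_le hT] at h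
  filter_upwards [h] with t ht htT
  have htI := Ioo_subset_Icc_self htT
  ext i j
  have h1 := ht i j htI 0 (left_mem_Icc.2 hT)
  rw [hfix t htI] at h1
  refine h1.unique ((hasDerivAt_const t (0 : ℂ)).congr_of_eventuallyEq ?_)
  filter_upwards [Ioo_mem_nhds htT.1 htT.2] with s hs
  have hs' := Ioo_subset_Icc_self hs
  have h2 := hρ.eq_integral s hs' i j
  rw [hfix s hs'] at h2
  simpa using h2

/-- Increments are dominated by a weighted sum of increments of the integrals of `‖𝓖 s (ρ s) i j‖`,
each absolutely continuous. -/
theorem absolutelyContinuousOnInterval_traceNorm {𝓖 : ℝ → Superop n} {T : ℝ} (hT : 0 ≤ T)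
    {X : Matrix n n ℂ} {ρ : ℝ → Matrix n n ℂ} (hρ : IsSolution 𝓖 T X ρ) :
    AbsolutelyContinuousOnInterval (fun t => traceNorm (ρ t - X)) 0 T := by
  have hF : ∀ i j, AbsolutelyContinuousOnInterval
      (fun x => ∫ s in (0 : ℝ)..x, ‖𝓖 s (ρ s) i j‖) 0 T := fun i j =>
    (hρ.integrable i j).norm.absolutelyContinuousOnInterval_intervalIntegral (by simp)
  have hlim : Tendsto (fun E : ℕ × (ℕ → ℝ × ℝ) => ∑ i : n, ∑ j : n,
      (∑ k ∈ Finset.range E.1, dist (∫ s in (0 : ℝ)..(E.2 k).1, ‖𝓖 s (ρ s) i j‖)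
        (∫ s in (0 : ℝ)..(E.2 k).2, ‖𝓖 s (ρ s) i j‖)) * traceNorm (Matrix.single i j (1 : ℂ)))
      (AbsolutelyContinuousOnInterval.totalLengthFilter ⊓
        𝓟 (AbsolutelyContinuousOnInterval.disjWithin 0 T)) (𝓝 0) := by
    have h0 : ∑ i : n, ∑ j : n, 0 * traceNorm (Matrix.single i j (1 : ℂ)) = 0 := by simp
    rw [← congrArg 𝓝 h0]
    exact tendsto_finsetSum _ fun i _ => tendsto_finsetSum _ fun j _ =>
      Tendsto.mul_const _ (hF i j)
  refine squeeze_zero' (Eventually.of_forall fun E => Finset.sum_nonneg fun _ _ => dist_nonneg)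
    ?_ hlim
  rw [eventually_inf_principal]
  refine Eventually.of_forall fun E hE => ?_
  have hrw : ∀ a : ℕ → n → n → ℝ, ∑ i, ∑ j, (∑ k ∈ Finset.range E.1, a k i j) *
      traceNorm (Matrix.single i j (1 : ℂ)) =
      ∑ k ∈ Finset.range E.1, ∑ i, ∑ j, a k i j * traceNorm (Matrix.single i j (1 : ℂ)) := by
    intro a
    simp only [Finset.sum_mul]
    rw [Finset.sum_comm]
    simp only [Finset.sum_comm (s := Finset.range E.1)]
    rw [Finset.sum_comm]
  rw [hrw]
  refine Finset.sum_le_sum fun k hk => ?_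
  obtain ⟨h1, h2⟩ := hE.1 k hk
  rw [uIcc_of_le hT] at h1 h2
  rw [Real.dist_eq]
  refine (abs_traceNorm_sub_le _ _).trans ((traceNorm_le_sum_norm _).trans ?_)
  refine Finset.sum_le_sum fun i _ => Finset.sum_le_sum fun j _ =>
    mul_le_mul_of_nonneg_right ?_ (traceNorm_nonneg _)
  have hint : ∀ x ∈ Icc 0 T, IntervalIntegrable (fun s => 𝓖 s (ρ s) i j) volume 0 x := fun x hx =>
    (hρ.integrable i j).mono_set (by
      rw [uIcc_of_le hT, uIcc_of_le hx.1]
      exact Icc_subset_Icc_right hx.2)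
  rw [Real.dist_eq, sub_sub_sub_cancel_right, Matrix.sub_apply, hρ.eq_integral _ h1,
    hρ.eq_integral _ h2, add_sub_add_left_eq_sub,
    intervalIntegral.integral_interval_sub_left (hint _ h1) (hint _ h2),
    intervalIntegral.integral_interval_sub_left (hint _ h1).norm (hint _ h2).norm]
  exact intervalIntegral.norm_integral_le_abs_integral_norm

/-- The trace norm of the deviation from the initial state grows at most at the rate `‖𝓖 t X‖₁`. -/
theorem ae_deriv_traceNorm_le {T : ℝ} (hT : 0 ≤ T) {H : ℝ → Matrix n n ℂ}
    (hH : ∀ t ∈ Icc 0 T, (H t).IsHermitian) {L : ι → Matrix n n ℂ}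
    {X : Matrix n n ℂ} {ρ : ℝ → Matrix n n ℂ}
    (hρ : IsSolution (fun t => lindbladGen (H t) L) T X ρ) :
    ∀ᵐ t, t ∈ Ioo 0 T → deriv (fun s => traceNorm (ρ s - X)) t ≤
      traceNorm (lindbladGen (H t) L X) := by
  have h : ∀ᵐ t, ∀ i j, t ∈ uIcc 0 T → ∀ c ∈ uIcc 0 T,
      HasDerivAt (fun x => ∫ s in c..x, lindbladGen (H s) L (ρ s) i j)
        (lindbladGen (H t) L (ρ t) i j) t :=
    ae_all_iff.2 fun i => ae_all_iff.2 fun j => (hρ.integrable i j).ae_hasDerivAt_integral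
  filter_upwards [h, (absolutelyContinuousOnInterval_traceNorm hT hρ).ae_differentiableAt]
    with t ht hdiff htT
  have htI := Ioo_subset_Icc_self htT
  rw [uIcc_of_le hT] at ht hdiff
  obtain ⟨Y, hY, hYt, hYd⟩ := exists_contraction_dissipative (hH t htI) L (ρ t - X)
  have hentry : ∀ i j, HasDerivAt (fun s => (ρ s - X) i j) (lindbladGen (H t) L (ρ t) i j) t := by
    intro i j
    refine (ht i j htI 0 (left_mem_Icc.2 hT)).congr_of_eventuallyEq ?_
    filter_upwards [Ioo_mem_nhds htT.1 htT.2] with s hs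
    rw [Matrix.sub_apply, hρ.eq_integral s (Ioo_subset_Icc_self hs) i j, add_sub_cancel_left]
  have htr : HasDerivAt (fun s => (Y * (ρ s - X)).trace)
      ((Y * lindbladGen (H t) L (ρ t)).trace) t := by
    simp only [Matrix.trace, Matrix.diag, Matrix.mul_apply]
    exact HasDerivAt.fun_sum fun i _ => HasDerivAt.fun_sum fun j _ => (hentry j i).const_mul _
  have hre : HasDerivAt (fun s => (Y * (ρ s - X)).trace.re)
      ((Y * lindbladGen (H t) L (ρ t)).trace.re) t :=
    Complex.reCLM.hasFDerivAt.comp_hasDerivAt t htr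
  -- With `Y` frozen at time `t`, duality makes this gap nonnegative and it vanishes at `t`, so both
  -- terms have the same derivative there.
  have hmin : IsLocalMin (fun s => traceNorm (ρ s - X) - (Y * (ρ s - X)).trace.re) t :=
    Eventually.of_forall fun s => by
      dsimp only
      rw [hYt, sub_self]
      exact sub_nonneg.2 (re_trace_mul_le_traceNorm hY _)
  have heq := hmin.hasDerivAt_eq_zero ((hdiff htI).hasDerivAt.sub hre)
  have hsplit : lindbladGen (H t) L (ρ t) =
      lindbladGen (H t) L (ρ t - X) + lindbladGen (H t) L X := by
    rw [← map_add, sub_add_cancel]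
  have h2 := re_trace_mul_le_traceNorm hY (lindbladGen (H t) L X)
  rw [hsplit, mul_add, trace_add, Complex.add_re] at heq
  linarith

theorem hamGen_sub_lindbladGen (H K : Matrix n n ℂ) (L : ι → Matrix n n ℂ) :
    hamGen K - lindbladGen H L = hamGen (K - H) - dissipator L := by
  rw [lindbladGen, hamGen_sub, sub_add_eq_sub_sub]

theorem intervalIntegrable_inducedNorm_sub {T : ℝ} {H H' : ℝ → Matrix n n ℂ}
    (hH : IsHamiltonian T H) (hH' : IsHamiltonian T H') (L : ι → Matrix n n ℂ) :
    IntervalIntegrable (fun t => inducedNorm (hamGen (H' t) - lindbladGen (H t) L)) volume 0 T := by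
  simp only [hamGen_sub_lindbladGen]
  exact intervalIntegrable_inducedNorm _ fun i j => (hH'.integrable i j).sub (hH.integrable i j)

/-- The integrated speed limit relative to a Hamiltonian evolution fixing the initial state. -/
theorem traceNorm_sub_le_integral {T : ℝ} (hT : 0 ≤ T) {H H' : ℝ → Matrix n n ℂ}
    (hH : IsHamiltonian T H) (hH' : IsHamiltonian T H') {L : ι → Matrix n n ℂ}
    {X : Matrix n n ℂ} (hX : IsDensity X) {ρ ρ' : ℝ → Matrix n n ℂ}
    (hρ : IsSolution (fun t => lindbladGen (H t) L) T X ρ)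
    (hρ' : IsSolution (fun t => hamGen (H' t)) T X ρ') (hfix : ∀ t ∈ Icc 0 T, ρ' t = X) :
    traceNorm (ρ T - X) ≤ ∫ t in (0 : ℝ)..T, inducedNorm (hamGen (H' t) - lindbladGen (H t) L) := by
  have hac := absolutelyContinuousOnInterval_traceNorm hT hρ
  have h0 : ρ 0 = X := by
    ext i j
    simpa using hρ.eq_integral 0 (left_mem_Icc.2 hT) i j
  have hftc := hac.integral_deriv_eq_sub
  rw [h0, sub_self, traceNorm_zero, sub_zero] at hftc
  rw [← hftc]
  refine intervalIntegral.integral_mono_ae_restrict hT hac.intervalIntegrable_deriv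
    (intervalIntegrable_inducedNorm_sub hH hH' L) ?_
  rw [EventuallyLE, ← restrict_Ioo_eq_restrict_Icc, ae_restrict_iff' measurableSet_Ioo]
  filter_upwards [ae_deriv_traceNorm_le hT hH.hermitian hρ, ae_apply_eq_zero_of_fixed hT hρ' hfix]
    with t h1 h2 ht
  have h3 := traceNorm_apply_le (hamGen (H' t) - lindbladGen (H t) L) X
  rw [LinearMap.sub_apply, h2 ht, zero_sub, traceNorm_neg] at h3
  refine (h1 ht).trans (h3.trans ?_)
  exact mul_le_of_le_one_right (inducedNorm_nonneg _) (traceNorm_le_one_of_isDensity hX)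

/-! ### The zero comparison Hamiltonian and the final assembly. -/

theorem isHamiltonian_zero (T : ℝ) : IsHamiltonian T (fun _ => (0 : Matrix n n ℂ)) :=
  ⟨fun _ _ => isHermitian_zero, fun _ _ => intervalIntegrable_const⟩

theorem isSolution_const (T : ℝ) (X : Matrix n n ℂ) :
    IsSolution (fun _ => hamGen (0 : Matrix n n ℂ)) T X fun _ => X := by
  refine ⟨continuousOn_const, fun i j => ?_, fun t _ i j => ?_⟩ <;> simp [hamGen_zero]

end OpenSystem

theorem mainTheorem2 {n ι : Type*} [Fintype n] [DecidableEq n] [Fintype ι]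
    (T : ℝ) (hT : 0 ≤ T)
    (H : ℝ → Matrix n n ℂ) (hH : OpenSystem.IsHamiltonian T H)
    (L : ι → Matrix n n ℂ)
    (ρ₀ : Matrix n n ℂ) (hρ₀ : OpenSystem.IsDensity ρ₀)
    (ρ : ℝ → Matrix n n ℂ)
    (hρ : OpenSystem.IsSolution (fun t => OpenSystem.lindbladGen (H t) L) T ρ₀ ρ) :
    (∀ (H' : ℝ → Matrix n n ℂ) (U' : ℝ → OpenSystem.Superop n),
      OpenSystem.IsHamiltonian T H' →
      OpenSystem.IsEvolution (fun t => OpenSystem.hamGen (H' t)) T U' →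
      (∀ t ∈ Set.Icc 0 T, U' t ρ₀ = ρ₀) →
      (IntervalIntegrable
          (fun t => OpenSystem.inducedNorm
            (OpenSystem.hamGen (H' t) - OpenSystem.lindbladGen (H t) L))
          MeasureTheory.volume 0 T ∧
        OpenSystem.traceNorm (ρ T - ρ₀) ≤
          ∫ t in (0 : ℝ)..T, OpenSystem.inducedNorm
            (OpenSystem.hamGen (H' t) - OpenSystem.lindbladGen (H t) L)) ∧
      (∀ M : ℝ,
        IsLUB ((fun t => OpenSystem.inducedNorm
          (OpenSystem.lindbladGen (H t) L - OpenSystem.hamGen (H' t))) '' Set.Icc 0 T) M →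
        0 < M → T ≥ OpenSystem.traceNorm (ρ T - ρ₀) / M) ∧
      (ContinuousOn H (Set.Icc 0 T) → ContinuousOn H' (Set.Icc 0 T) →
        ∃ M : ℝ, IsGreatest ((fun t => OpenSystem.inducedNorm
          (OpenSystem.lindbladGen (H t) L - OpenSystem.hamGen (H' t))) '' Set.Icc 0 T) M)) ∧
    (IntervalIntegrable (fun t => OpenSystem.inducedNorm (OpenSystem.lindbladGen (H t) L))
        MeasureTheory.volume 0 T ∧
      OpenSystem.traceNorm (ρ T - ρ₀) ≤
        ∫ t in (0 : ℝ)..T, OpenSystem.inducedNorm (OpenSystem.lindbladGen (H t) L)) ∧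
    (0 < T →
      0 < (∫ t in (0 : ℝ)..T, OpenSystem.inducedNorm (OpenSystem.lindbladGen (H t) L)) →
      T ≥ OpenSystem.traceNorm (ρ T - ρ₀) /
        ((1 / T) * ∫ t in (0 : ℝ)..T, OpenSystem.inducedNorm (OpenSystem.lindbladGen (H t) L))) := by

  have key : ∀ M : ℝ, 0 < M → OpenSystem.traceNorm (ρ T - ρ₀) ≤ T * M →
      T ≥ OpenSystem.traceNorm (ρ T - ρ₀) / M := fun M hM h => (div_le_iff₀ hM).2 h
  have hint : IntervalIntegrable (fun t => OpenSystem.inducedNorm (OpenSystem.lindbladGen (H t) L))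
      MeasureTheory.volume 0 T := by
    have h := OpenSystem.intervalIntegrable_inducedNorm_sub hH (OpenSystem.isHamiltonian_zero T) L
    simpa only [OpenSystem.hamGen_zero, zero_sub, OpenSystem.inducedNorm_neg] using h
  have hle : OpenSystem.traceNorm (ρ T - ρ₀) ≤
      ∫ t in (0 : ℝ)..T, OpenSystem.inducedNorm (OpenSystem.lindbladGen (H t) L) := by
    have h := OpenSystem.traceNorm_sub_le_integral hT hH (OpenSystem.isHamiltonian_zero T) hρ₀ hρ
      (OpenSystem.isSolution_const T ρ₀) fun _ _ => rfl
    simpa only [OpenSystem.hamGen_zero, zero_sub, OpenSystem.inducedNorm_neg] using h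
  refine ⟨fun H' U' hH' hU' hfix => ?_, ⟨hint, hle⟩, fun hT0 hI => ?_⟩
  · have hint' := OpenSystem.intervalIntegrable_inducedNorm_sub hH hH' L
    have hle' := OpenSystem.traceNorm_sub_le_integral hT hH hH' hρ₀ hρ (hU' ρ₀) hfix
    refine ⟨⟨hint', hle'⟩, fun M hM hM0 => key M hM0 (hle'.trans ?_), fun hc hc' => ?_⟩
    · have hmono := intervalIntegral.integral_mono_on hT hint' intervalIntegrable_const
        fun t ht => (OpenSystem.inducedNorm_sub_comm _ _).trans_le (hM.1 ⟨t, ht, rfl⟩)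
      simpa using hmono
    · have hcont : ContinuousOn (fun t => OpenSystem.inducedNorm
          (OpenSystem.lindbladGen (H t) L - OpenSystem.hamGen (H' t))) (Set.Icc 0 T) := by
        simp only [OpenSystem.inducedNorm_sub_comm (OpenSystem.lindbladGen _ _),
          OpenSystem.hamGen_sub_lindbladGen]
        exact (OpenSystem.continuous_inducedNorm_hamGen_sub _).comp_continuousOn (hc'.sub hc)
      exact (isCompact_Icc.image_of_continuousOn hcont).exists_isGreatest
        ((Set.nonempty_Icc.2 hT).image _)
  · refine key _ (by positivity) (hle.trans_eq ?_)
    field_simp
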